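/- Let $p=(p_0,\dots,p_{m-1})$ be a probability vector with all $p_a>0$, let $W_k$ be a word of $k$ i.i.d. letters with law $p$, so $P(W_k=w)=\prod_i p_{w_i}$, and let $H_W=h(p)$ be its specific Shannon entropy, where $h(l)=-\sum_a l_a\log l_a$ and $D(l\|p)=-\sum_a l_a\log(p_a/l_a)$ for probability vectors $l$. Fix $\epsilon>0$ and let $T_k^\epsilon=\{w: e^{-k(H_W+\epsilon)}\le P(W_k=w)\le e^{-k(H_W-\epsilon)}\}$. Let $W_k^\epsilon$ have the law of $W_k$ conditioned on $T_k^\epsilon$, and let $U_k^\epsilon$ be uniform on $T_k^\epsilon$. For a source $X_k$ let $G$ be a Guesswork function: a bijection from the words of length $k$ onto $\{1,\dots,m^k\}$ with $G(w')<G(w)$ whenever $P(X_k=w')>P(X_k=w)$. Let $\Lambda_X(\alpha)=\lim_k \frac1k\log E(e^{\alpha\log G(X_k)})$, and let $R_X(\beta)=\lim_k\frac1k\frac1{1-\beta}\log\sum_w P(X_k=w)^\beta$ be the specific Rényi entropy ($R_X(1)$ being the specific Shannon entropy). Let $l^-$ (respectively $l^+$) maximize $h(l)$ over probability vectors with $h(l)+D(l\|p)-\epsilon=h(p)$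 (respectively $h(l)+D(l\|p)+\epsilon=h(p)$), should such a maximizer exist. For $\alpha>-1$ let $$l^W_a(\alpha)=\frac{p_a^{1/(1+\alpha)}}{\sum_b p_b^{1/(1+\alpha)}},\qquad \eta(\alpha)=-\sum_a l_a^W(\alpha)\log p_a,$$ $$l^*(\alpha)=\begin{cases} l^+ & \text{if }\eta(\alpha)\le h(p)-\epsilon,\\ l^W(\alpha) & \text{if } h(p)-\epsilon<\eta(\alpha)<h(p)+\epsilon,\\ l^- & \text{if }\eta(\alpha)\ge h(p)+\epsilon.\end{cases}$$ Then for $X=U^\epsilon$ and for $X=W^\epsilon$ and every $\alpha>-1$ the limits $\Lambda_X(\alpha)$ and $R_X(1/(1+\alpha))$ exist, $\Lambda_X(\alpha)=\alpha R_X(1/(1+\alpha))$, and $\Lambda_X$ has a continuous derivative on $(-1,\infty)$. Moreover $$\Lambda_{W^\epsilon}(\alpha)=\alpha h(l^*(\alpha))-D(l^*(\alpha)\|p),$$ and, if $h(p)+\epsilon\le\log m$, then $\Lambda_{U^\epsilon}(\alpha)=\alpha h(l^-)$. If instead $h(p)+\epsilon>\log m$, then $\Lambda_{U^\epsilon}(\alpha)=\alpha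 h(l^-)$ when $h(p)+\epsilon<-\frac1m\sum_a\log p_a$, and $\Lambda_{U^\epsilon}(\alpha)=\alpha\log m$ when $h(p)+\epsilon\ge-\frac1m\sum_a\log p_a$. -/

import Mathlib

open Filter Topology

noncomputable section

namespace Guesswork

/-- Words of length `k` over the alphabet `{0, …, m - 1}`. -/
abbrev Word (m k : ℕ) : Type := Fin k → Fin m

/-- A word source: for each length `k`, the probability mass function of the random word of
length `k`. -/
abbrev Source (m : ℕ) : Type := (k : ℕ) → Word m k → ℝ

/-- Shannon entropy `- ∑ P log P` (natural logarithm) of a mass function on a finite type.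
On probability vectors over the alphabet this is `h(l)`. -/
def shannonEntropy {Ω : Type*} [Fintype Ω] (P : Ω → ℝ) : ℝ :=
  -∑ w, P w * Real.log (P w)

/-- Rényi entropy of order `β > 0`, with the usual convention that order one is the Shannon
entropy. -/
def renyiEntropy {Ω : Type*} [Fintype Ω] (β : ℝ) (P : Ω → ℝ) : ℝ :=
  if β = 1 then shannonEntropy P else 1 / (1 - β) * Real.log (∑ w, P w ^ β)

/-- The specific Shannon entropy of the source exists and equals `H`. -/
def HasSpecificEntropy {m : ℕ} (Q : Source m) (H : ℝ) : Prop :=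
  Tendsto (fun k : ℕ => 1 / (k : ℝ) * shannonEntropy (Q k)) atTop (𝓝 H)

/-- The specific Rényi entropy of order `β` of the source exists and equals `R`. -/
def HasSpecificRenyiEntropy {m : ℕ} (Q : Source m) (β R : ℝ) : Prop :=
  Tendsto (fun k : ℕ => 1 / (k : ℝ) * renyiEntropy β (Q k)) atTop (𝓝 R)

/-- Words made of i.i.d. letters with letter distribution `p`. -/
def iidSource {m : ℕ} (p : Fin m → ℝ) : Source m := fun _ w => ∏ i, p (w i)

/-- The `ε`-typical set of words of length `k` of a source with specific Shannon entropy `H`. -/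
def typicalSet {m : ℕ} (Q : Source m) (H ε : ℝ) (k : ℕ) : Finset (Word m k) :=
  Finset.univ.filter fun w =>
    Real.exp (-(k : ℝ) * (H + ε)) ≤ Q k w ∧ Q k w ≤ Real.exp (-(k : ℝ) * (H - ε))

/-- The source `Q` conditioned on the typical set. -/
def conditionedSource {m : ℕ} (Q : Source m) (H ε : ℝ) : Source m := fun k w =>
  if w ∈ typicalSet Q H ε k then Q k w / ∑ v ∈ typicalSet Q H ε k, Q k v else 0

/-- The uniform distribution on the typical set of `Q`. -/
def uniformSource {m : ℕ} (Q : Source m) (H ε : ℝ) : Source m := fun k w =>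
  if w ∈ typicalSet Q H ε k then 1 / ((typicalSet Q H ε k).card : ℝ) else 0

/-- `G` is a Guesswork function for the mass function `P`: it numbers the words `1, …, m ^ k`,
and words that are strictly more likely under `P` are guessed strictly earlier
(ties are broken arbitrarily). -/
def IsGuesswork {m k : ℕ} (P : Word m k → ℝ) (G : Word m k → ℕ) : Prop :=
  Set.BijOn G Set.univ (Set.Icc 1 (m ^ k)) ∧ ∀ w w', P w < P w' → G w' < G w

/-- The scaled cumulant generating function of `k⁻¹ log G` under the source exists at `α` and
has the value `c`. -/
def HasSCGF {m : ℕ} (Q : Source m) (G : (k : ℕ) → Word m k → ℕ) (α c : ℝ) : Prop :=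
  Tendsto (fun k : ℕ => 1 / (k : ℝ) *
    Real.log (∑ w, Q k w * Real.exp (α * Real.log (G k w : ℝ)))) atTop (𝓝 c)

/-- On `(-1, ∞)` the scaled cumulant generating function exists and is `Λ`, it equals
`α R(1 / (1 + α))` with `R` the specific Rényi entropy, and it has a continuous derivative. -/
structure RegularSCGF {m : ℕ} (Q : Source m) (G : (k : ℕ) → Word m k → ℕ) (Λ : ℝ → ℝ) :
    Prop where
  hasSCGF : ∀ α : ℝ, -1 < α → HasSCGF Q G α (Λ α)
  eq_renyi : ∀ α : ℝ, -1 < α → ∃ R : ℝ,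
    HasSpecificRenyiEntropy Q (1 / (1 + α)) R ∧ Λ α = α * R
  contDeriv : ∃ Λ' : ℝ → ℝ, ContinuousOn Λ' (Set.Ioi (-1)) ∧
    ∀ α : ℝ, -1 < α → HasDerivAt Λ (Λ' α) α

/-- Relative entropy `D(l‖p)`, for `p` with positive entries. -/
def relEntropy {m : ℕ} (l p : Fin m → ℝ) : ℝ := -∑ a, l a * Real.log (p a / l a)

/-- `l` is a choice of `l⁻`: it maximizes `h` over the probability vectors with
`h(l) + D(l‖p) - ε = h(p)`. -/
def IsLMinus {m : ℕ} (p : Fin m → ℝ) (ε : ℝ) (l : Fin m → ℝ) : Prop :=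
  (l ∈ stdSimplex ℝ (Fin m) ∧ shannonEntropy l + relEntropy l p - ε = shannonEntropy p) ∧
  ∀ l' ∈ stdSimplex ℝ (Fin m), shannonEntropy l' + relEntropy l' p - ε = shannonEntropy p →
    shannonEntropy l' ≤ shannonEntropy l

/-- `l` is a choice of `l⁺`: it maximizes `h` over the probability vectors with
`h(l) + D(l‖p) + ε = h(p)`. -/
def IsLPlus {m : ℕ} (p : Fin m → ℝ) (ε : ℝ) (l : Fin m → ℝ) : Prop :=
  (l ∈ stdSimplex ℝ (Fin m) ∧ shannonEntropy l + relEntropy l p + ε = shannonEntropy p) ∧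
  ∀ l' ∈ stdSimplex ℝ (Fin m), shannonEntropy l' + relEntropy l' p + ε = shannonEntropy p →
    shannonEntropy l' ≤ shannonEntropy l

/-- The tilted distribution `l^W(α)`. -/
def tilted {m : ℕ} (p : Fin m → ℝ) (α : ℝ) : Fin m → ℝ := fun a =>
  p a ^ (1 / (1 + α)) / ∑ b, p b ^ (1 / (1 + α))

/-- `η(α) = - ∑ l^W_a(α) log p_a`. -/
def eta {m : ℕ} (p : Fin m → ℝ) (α : ℝ) : ℝ := -∑ a, tilted p α a * Real.log (p a)

/-- `l*(α)`: the tilted distribution, replaced by `l⁺` or `l⁻` when `η(α)` leaves the interval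
`(h(p) - ε, h(p) + ε)`. -/
def lStar {m : ℕ} (p : Fin m → ℝ) (ε : ℝ) (lminus lplus : Fin m → ℝ) (α : ℝ) : Fin m → ℝ :=
  if eta p α ≤ shannonEntropy p - ε then lplus
  else if eta p α < shannonEntropy p + ε then tilted p α
  else lminus

end Guesswork

end

open Guesswork

/-! Put β = 1/(1+α). Guessing in order of decreasing probability gives G(w) ≤ (∑ P^β) / P(w)^β.
Hölder's inequality against ∑ 1/G, a harmonic number of size O(k), gives the converse. So E G^α
equals (∑ P^β)^(1+α) up to a factor polynomial in k (`IsGuesswork.abs_log_moment_sub_le`), and Λ is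
read off from the growth rate of power sums. For both sources these reduce to power sums of the
i.i.d. law over the typical set, with exponent β for the conditioned source and 0 for the uniform
one.

Since h(l) + D(l‖p) is the cross entropy of l against p, a word is typical when the cross entropy of
its empirical distribution is within ε of h(p). The rate is the maximum of h minus β times the cross
entropy over that window (`tendsto_log_typicalSum`): exponential tilting bounds it above, a change
of measure with the weak law below. The maximizer is a Gibbs distribution p^θ/Z, with θ = β if that
is admissible, and otherwise with θ moved until the cross entropy is at the nearer end. By the Gibbs
variational inequality, the Gibbs distributions at the ends are choices of l⁻ and l⁺.

Finally, Λ for the conditioned source is a maximum of the affine functions α h(l) - D(l‖p), so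
h(l*(α)) is a subgradient. It is continuous in α, hence it is the derivative
(`hasDerivAt_of_subgradient`). -/

namespace Guesswork

/-! ### Moments of sums of i.i.d. letters -/

lemma sum_word_succ {m k : ℕ} (F : Word m (k + 1) → ℝ) :
    ∑ w, F w = ∑ a, ∑ w : Word m k, F (Fin.cons a w) := by
  rw [← Fintype.sum_prod_type' (f := fun a (w : Word m k) => F (Fin.cons a w))]
  exact (Fintype.sum_equiv (Fin.consEquiv fun _ => Fin m) _ _ fun _ => rfl).symm

lemma sum_iid_mul {m : ℕ} (l : Fin m → ℝ) (k : ℕ) :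
    ∑ w : Word m k, ∏ i, l (w i) = (∑ a, l a) ^ k := by
  induction k with
  | zero => simp
  | succ k ih =>
    rw [sum_word_succ]
    simp only [Fin.prod_univ_succ, Fin.cons_zero, Fin.cons_succ, ← Finset.mul_sum, ih]
    rw [← Finset.sum_mul]; ring

lemma sum_iid_mul_sum {m : ℕ} {l : Fin m → ℝ} (hl : ∑ a, l a = 1) (f : Fin m → ℝ) (k : ℕ) :
    ∑ w : Word m k, (∏ i, l (w i)) * ∑ i, f (w i) = k * ∑ a, l a * f a := by
  induction k with
  | zero => simp
  | succ k ih =>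
    rw [sum_word_succ]
    simp only [Fin.prod_univ_succ, Fin.sum_univ_succ, Fin.cons_zero, Fin.cons_succ]
    have h : ∀ a, ∑ w : Word m k, (l a * ∏ i, l (w i)) * (f a + ∑ i, f (w i))
        = l a * f a + l a * (k * ∑ a, l a * f a) := by
      intro a
      rw [← ih, Finset.mul_sum]
      have : l a * f a = ∑ w : Word m k, (l a * f a) * ∏ i, l (w i) := by
        rw [← Finset.mul_sum, sum_iid_mul, hl, one_pow, mul_one]
      rw [this, ← Finset.sum_add_distrib]
      exact Finset.sum_congr rfl fun w _ => by ring
    simp only [h, Finset.sum_add_distrib, ← Finset.sum_mul, hl]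
    push_cast; ring

lemma sum_iid_mul_sum_sq {m : ℕ} {l : Fin m → ℝ} (hl : ∑ a, l a = 1) {f : Fin m → ℝ}
    (hf : ∑ a, l a * f a = 0) (k : ℕ) :
    ∑ w : Word m k, (∏ i, l (w i)) * (∑ i, f (w i)) ^ 2 = k * ∑ a, l a * f a ^ 2 := by
  induction k with
  | zero => simp
  | succ k ih =>
    rw [sum_word_succ]
    simp only [Fin.prod_univ_succ, Fin.sum_univ_succ, Fin.cons_zero, Fin.cons_succ]
    have h : ∀ a, ∑ w : Word m k, (l a * ∏ i, l (w i)) * (f a + ∑ i, f (w i)) ^ 2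
        = l a * f a ^ 2 + l a * (k * ∑ a, l a * f a ^ 2) := by
      intro a
      have h0 : l a * f a ^ 2 = ∑ w : Word m k, (l a * f a ^ 2) * ∏ i, l (w i) := by
        rw [← Finset.mul_sum, sum_iid_mul, hl, one_pow, mul_one]
      -- The cross term of the square, zero because `f` is centred; adding it completes the square.
      have h1 : 0 = ∑ w : Word m k, (2 * l a * f a) * ((∏ i, l (w i)) * ∑ i, f (w i)) := by
        rw [← Finset.mul_sum, sum_iid_mul_sum hl, hf]; ring
      rw [← ih, Finset.mul_sum, ← add_zero (l a * f a ^ 2 + _), h1, h0,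
        ← Finset.sum_add_distrib, ← Finset.sum_add_distrib]
      exact Finset.sum_congr rfl fun w _ => by ring
    simp only [h, Finset.sum_add_distrib, ← Finset.sum_mul, hl]
    push_cast; ring

/-- The second moment of a centred sum of `k` i.i.d. letters grows linearly in `k`. -/
lemma exists_second_moment_bound {m : ℕ} {l : Fin m → ℝ} (hl : l ∈ stdSimplex ℝ (Fin m))
    (f : Fin m → ℝ) : ∃ V : ℝ, 0 ≤ V ∧ ∀ k : ℕ,
      ∑ w : Word m k, (∏ i, l (w i)) * (∑ i, f (w i) - k * ∑ a, l a * f a) ^ 2 = k * V := by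
  refine ⟨∑ a, l a * (f a - ∑ b, l b * f b) ^ 2,
    Finset.sum_nonneg fun a _ => mul_nonneg (hl.1 a) (sq_nonneg _), fun k => ?_⟩
  rw [← sum_iid_mul_sum_sq hl.2]
  · refine Finset.sum_congr rfl fun w _ => ?_
    simp [Finset.sum_sub_distrib]
  · simp only [mul_sub, Finset.sum_sub_distrib, ← Finset.sum_mul, hl.2]; ring

/-! ### Gibbs distributions and the variational inequality -/

/-- The cross entropy `-∑ l log p`. -/
noncomputable def crossEntropy {m : ℕ} (p l : Fin m → ℝ) : ℝ := -∑ a, l a * Real.log (p a)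

/-- The Gibbs distribution proportional to `p ^ θ`. -/
noncomputable def gibbs {m : ℕ} (p : Fin m → ℝ) (θ : ℝ) : Fin m → ℝ := fun a =>
  p a ^ θ / ∑ b, p b ^ θ

section Gibbs

variable {m : ℕ} {p : Fin m → ℝ}

lemma relEntropy_eq (hpos : ∀ a, 0 < p a) (l : Fin m → ℝ) :
    relEntropy l p = crossEntropy p l - shannonEntropy l := by
  rw [relEntropy, crossEntropy, shannonEntropy, sub_neg_eq_add, neg_add_eq_sub,
    ← Finset.sum_sub_distrib, ← Finset.sum_neg_distrib]
  refine Finset.sum_congr rfl fun a _ => ?_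
  by_cases h : l a = 0
  · simp [h]
  · rw [Real.log_div (hpos a).ne' h]; ring

lemma nonempty_of_mem_stdSimplex (hp : p ∈ stdSimplex ℝ (Fin m)) : Nonempty (Fin m) := by
  by_contra h
  rw [not_nonempty_iff] at h
  have := hp.2
  simp at this

lemma partition_pos (hp : p ∈ stdSimplex ℝ (Fin m)) (hpos : ∀ a, 0 < p a) (θ : ℝ) :
    0 < ∑ b, p b ^ θ := by
  have := nonempty_of_mem_stdSimplex hp
  exact Finset.sum_pos (fun a _ => Real.rpow_pos_of_pos (hpos a) _) Finset.univ_nonempty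

lemma gibbs_pos (hp : p ∈ stdSimplex ℝ (Fin m)) (hpos : ∀ a, 0 < p a) (θ : ℝ) (a : Fin m) :
    0 < gibbs p θ a :=
  div_pos (Real.rpow_pos_of_pos (hpos a) _) (partition_pos hp hpos θ)

lemma gibbs_mem (hp : p ∈ stdSimplex ℝ (Fin m)) (hpos : ∀ a, 0 < p a) (θ : ℝ) :
    gibbs p θ ∈ stdSimplex ℝ (Fin m) := by
  refine ⟨fun a => (gibbs_pos hp hpos θ a).le, ?_⟩
  simp only [gibbs]
  rw [← Finset.sum_div, div_self (partition_pos hp hpos θ).ne']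

lemma log_gibbs (hp : p ∈ stdSimplex ℝ (Fin m)) (hpos : ∀ a, 0 < p a) (θ : ℝ) (a : Fin m) :
    Real.log (gibbs p θ a) = θ * Real.log (p a) - Real.log (∑ b, p b ^ θ) := by
  rw [gibbs, Real.log_div (Real.rpow_pos_of_pos (hpos a) _).ne' (partition_pos hp hpos θ).ne',
    Real.log_rpow (hpos a)]

lemma gibbs_one (hp : p ∈ stdSimplex ℝ (Fin m)) : gibbs p 1 = p := by
  ext a
  simp [gibbs, hp.2]

lemma crossEntropy_gibbs (hp : p ∈ stdSimplex ℝ (Fin m)) (hpos : ∀ a, 0 < p a) (θ : ℝ)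
    {l : Fin m → ℝ} (hl : l ∈ stdSimplex ℝ (Fin m)) :
    crossEntropy (gibbs p θ) l = Real.log (∑ b, p b ^ θ) + θ * crossEntropy p l := by
  simp only [crossEntropy, log_gibbs hp hpos, mul_sub, Finset.sum_sub_distrib, ← Finset.sum_mul,
    hl.2, mul_left_comm _ θ, ← Finset.mul_sum]
  ring

lemma shannonEntropy_gibbs (hp : p ∈ stdSimplex ℝ (Fin m)) (hpos : ∀ a, 0 < p a) (θ : ℝ) :
    shannonEntropy (gibbs p θ)
      = Real.log (∑ b, p b ^ θ) + θ * crossEntropy p (gibbs p θ) :=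
  crossEntropy_gibbs hp hpos θ (gibbs_mem hp hpos θ)

lemma shannonEntropy_le_crossEntropy {l q : Fin m → ℝ} (hl : l ∈ stdSimplex ℝ (Fin m))
    (hq : q ∈ stdSimplex ℝ (Fin m)) (hqpos : ∀ a, 0 < q a) :
    shannonEntropy l ≤ crossEntropy q l := by
  have h : ∀ a, l a * Real.log (q a) - l a * Real.log (l a) ≤ q a - l a := by
    intro a
    rcases (hl.1 a).eq_or_lt with h | h
    · rw [← h]; simpa using (hqpos a).le
    · have := Real.log_le_sub_one_of_pos (div_pos (hqpos a) h)
      rw [Real.log_div (hqpos a).ne' h.ne'] at this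
      calc _ = l a * (Real.log (q a) - Real.log (l a)) := by ring
        _ ≤ l a * (q a / l a - 1) := by gcongr
        _ = q a - l a := by field_simp
  have := Finset.sum_le_sum fun a (_ : a ∈ Finset.univ) => h a
  simp only [Finset.sum_sub_distrib, hl.2, hq.2] at this
  unfold shannonEntropy crossEntropy
  linarith

/-- Gibbs' inequality against `gibbs p θ`, whose log-density is affine in `log p`. Equality holds at
`l = gibbs p θ`; all later optimality claims rest on this. -/
lemma shannonEntropy_le_log_partition (hp : p ∈ stdSimplex ℝ (Fin m)) (hpos : ∀ a, 0 < p a)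
    (θ : ℝ) {l : Fin m → ℝ} (hl : l ∈ stdSimplex ℝ (Fin m)) :
    shannonEntropy l ≤ Real.log (∑ b, p b ^ θ) + θ * crossEntropy p l := by
  rw [← crossEntropy_gibbs hp hpos θ hl]
  exact shannonEntropy_le_crossEntropy hl (gibbs_mem hp hpos θ) (gibbs_pos hp hpos θ)

/-- Test each of the two Gibbs distributions in the variational inequality of the other and add: (β
- θ) times the drop in cross entropy is nonnegative. -/
lemma crossEntropy_gibbs_antitone (hp : p ∈ stdSimplex ℝ (Fin m)) (hpos : ∀ a, 0 < p a) :
    Antitone fun θ => crossEntropy p (gibbs p θ) := by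
  intro θ β h
  rcases h.eq_or_lt with rfl | h
  · exact le_rfl
  have h1 := shannonEntropy_le_log_partition hp hpos β (gibbs_mem hp hpos θ)
  have h2 := shannonEntropy_le_log_partition hp hpos θ (gibbs_mem hp hpos β)
  rw [shannonEntropy_gibbs hp hpos] at h1 h2
  show crossEntropy p (gibbs p β) ≤ crossEntropy p (gibbs p θ)
  nlinarith

lemma crossEntropy_gibbs_one (hp : p ∈ stdSimplex ℝ (Fin m)) :
    crossEntropy p (gibbs p 1) = shannonEntropy p := by
  rw [gibbs_one hp]; rfl

lemma continuous_partition (hpos : ∀ a, 0 < p a) : Continuous fun θ : ℝ => ∑ b, p b ^ θ :=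
  continuous_finsetSum _ fun b _ => Real.continuous_const_rpow (hpos b).ne'

lemma continuous_crossEntropy_gibbs (hp : p ∈ stdSimplex ℝ (Fin m)) (hpos : ∀ a, 0 < p a) :
    Continuous fun θ => crossEntropy p (gibbs p θ) := by
  unfold crossEntropy gibbs
  refine (continuous_finsetSum _ fun a _ => Continuous.mul (Continuous.div
    (Real.continuous_const_rpow (hpos a).ne') (continuous_partition hpos) fun θ =>
      (partition_pos hp hpos θ).ne') continuous_const).neg

lemma continuous_shannonEntropy_gibbs (hp : p ∈ stdSimplex ℝ (Fin m)) (hpos : ∀ a, 0 < p a) :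
    Continuous fun θ => shannonEntropy (gibbs p θ) := by
  simp only [shannonEntropy_gibbs hp hpos]
  exact ((continuous_partition hpos).log fun θ => (partition_pos hp hpos θ).ne').add
    (continuous_id.mul (continuous_crossEntropy_gibbs hp hpos))

/-- The constraint fixes the cross entropy, so the variational bound is the same number for every
competitor, and the Gibbs distribution attains it. The sign of `ε` plays no role, which yields the
case of l⁺ as well. -/
lemma gibbs_isLMinus (hp : p ∈ stdSimplex ℝ (Fin m)) (hpos : ∀ a, 0 < p a) {θ ε : ℝ}
    (h : crossEntropy p (gibbs p θ) = shannonEntropy p + ε) : IsLMinus p ε (gibbs p θ) := by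
  refine ⟨⟨gibbs_mem hp hpos θ, ?_⟩, fun l hl he => ?_⟩
  · rw [relEntropy_eq hpos, h]; ring
  · rw [relEntropy_eq hpos] at he
    rw [shannonEntropy_gibbs hp hpos, h]
    convert shannonEntropy_le_log_partition hp hpos θ hl using 3
    linarith

lemma gibbs_isLPlus (hp : p ∈ stdSimplex ℝ (Fin m)) (hpos : ∀ a, 0 < p a) {θ ε : ℝ}
    (h : crossEntropy p (gibbs p θ) = shannonEntropy p - ε) : IsLPlus p ε (gibbs p θ) := by
  have := gibbs_isLMinus hp hpos (θ := θ) (ε := -ε) (by rw [h]; ring)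
  simpa only [IsLMinus, IsLPlus, sub_neg_eq_add] using this

lemma IsLMinus.crossEntropy_eq (hpos : ∀ a, 0 < p a) {ε : ℝ} {l : Fin m → ℝ}
    (h : IsLMinus p ε l) : crossEntropy p l = shannonEntropy p + ε := by
  have := h.1.2
  rw [relEntropy_eq hpos] at this
  linarith

/-- Uniqueness of the maximizer is not needed: only its entropy and cross entropy enter Λ. -/
lemma IsLMinus.shannonEntropy_eq {ε : ℝ} {l l' : Fin m → ℝ}
    (h : IsLMinus p ε l) (h' : IsLMinus p ε l') : shannonEntropy l = shannonEntropy l' :=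
  le_antisymm (h'.2 l h.1.1 h.1.2) (h.2 l' h'.1.1 h'.1.2)

lemma IsLPlus.crossEntropy_eq (hpos : ∀ a, 0 < p a) {ε : ℝ} {l : Fin m → ℝ}
    (h : IsLPlus p ε l) : crossEntropy p l = shannonEntropy p - ε := by
  have := h.1.2
  rw [relEntropy_eq hpos] at this
  linarith

lemma IsLPlus.shannonEntropy_eq {ε : ℝ} {l l' : Fin m → ℝ}
    (h : IsLPlus p ε l) (h' : IsLPlus p ε l') : shannonEntropy l = shannonEntropy l' :=
  le_antisymm (h'.2 l h.1.1 h.1.2) (h.2 l' h'.1.1 h'.1.2)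

end Gibbs

/-! ### Growth rate of power sums over the typical set -/

/-- Weak law of large numbers, for two letter functions at once. -/
lemma eventually_half_le_mass {m : ℕ} {l : Fin m → ℝ} (hl : l ∈ stdSimplex ℝ (Fin m))
    (f g : Fin m → ℝ) {δ : ℝ} (hδ : 0 < δ) :
    ∀ᶠ k : ℕ in atTop, 1 / 2 ≤ ∑ w : Word m k with
      |∑ i, f (w i) - k * ∑ a, l a * f a| ≤ k * δ ∧
      |∑ i, g (w i) - k * ∑ a, l a * g a| ≤ k * δ, ∏ i, l (w i) := by
  obtain ⟨V, hV, hfV⟩ := exists_second_moment_bound hl f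
  obtain ⟨U, hU, hgU⟩ := exists_second_moment_bound hl g
  filter_upwards [eventually_gt_atTop 0,
    tendsto_natCast_atTop_atTop.eventually_ge_atTop (2 * (V + U) / δ ^ 2)] with k hk hkV
  have hk' : (0 : ℝ) < k := by exact_mod_cast hk
  have htot := sum_iid_mul l k
  rw [hl.2, one_pow, ← Finset.sum_filter_add_sum_filter_not _ (fun w : Word m k =>
      |∑ i, f (w i) - k * ∑ a, l a * f a| ≤ k * δ ∧
      |∑ i, g (w i) - k * ∑ a, l a * g a| ≤ k * δ)] at htot
  suffices h : ∑ w : Word m k with ¬ (|∑ i, f (w i) - k * ∑ a, l a * f a| ≤ k * δ ∧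
      |∑ i, g (w i) - k * ∑ a, l a * g a| ≤ k * δ), ∏ i, l (w i) ≤ 1 / 2 by linarith
  have hnn : ∀ w : Word m k, 0 ≤ ∏ i, l (w i) := fun w => Finset.prod_nonneg fun i _ => hl.1 _
  calc _ ≤ ∑ w : Word m k with ¬ (|∑ i, f (w i) - k * ∑ a, l a * f a| ≤ k * δ ∧
      |∑ i, g (w i) - k * ∑ a, l a * g a| ≤ k * δ),
        ((∏ i, l (w i)) * (∑ i, f (w i) - k * ∑ a, l a * f a) ^ 2
          + (∏ i, l (w i)) * (∑ i, g (w i) - k * ∑ a, l a * g a) ^ 2) / (k * δ) ^ 2 := by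
        -- Chebyshev: off the event, one of the two squared deviations exceeds (kδ)².
        refine Finset.sum_le_sum fun w hw => ?_
        rw [Finset.mem_filter] at hw
        rw [le_div_iff₀ (by positivity), ← mul_add]
        refine mul_le_mul_of_nonneg_left ?_ (hnn w)
        by_contra! hlt
        refine hw.2 ⟨abs_le_of_sq_le_sq ?_ (by positivity), abs_le_of_sq_le_sq ?_ (by positivity)⟩
          <;> nlinarith [sq_nonneg (∑ i, f (w i) - k * ∑ a, l a * f a),
            sq_nonneg (∑ i, g (w i) - k * ∑ a, l a * g a)]
    _ ≤ ∑ w : Word m k, ((∏ i, l (w i)) * (∑ i, f (w i) - k * ∑ a, l a * f a) ^ 2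
          + (∏ i, l (w i)) * (∑ i, g (w i) - k * ∑ a, l a * g a) ^ 2) / (k * δ) ^ 2 :=
        Finset.sum_le_sum_of_subset_of_nonneg (Finset.filter_subset _ _) fun w _ _ => by
          have := hnn w; positivity
    _ = (V + U) / (k * δ ^ 2) := by
        rw [← Finset.sum_div, Finset.sum_add_distrib, hfV, hgU]; field_simp
    _ ≤ 1 / 2 := by
        rw [div_le_iff₀ (by positivity)] at hkV
        rw [div_le_iff₀ (by positivity)]; linarith

/-- The sum of `P(w) ^ β` over the typical words of length `k`. -/
noncomputable def typicalSum {m : ℕ} (p : Fin m → ℝ) (H ε β : ℝ) (k : ℕ) : ℝ :=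
  ∑ w ∈ typicalSet (iidSource p) H ε k, iidSource p k w ^ β

section Typical

variable {m : ℕ} {p : Fin m → ℝ}

lemma iidSource_eq_exp {l : Fin m → ℝ} (hpos : ∀ a, 0 < l a) {k : ℕ} (w : Word m k) :
    iidSource l k w = Real.exp (-∑ i, -Real.log (l (w i))) := by
  rw [Finset.sum_neg_distrib, neg_neg, Real.exp_sum]
  exact Finset.prod_congr rfl fun i _ => (Real.exp_log (hpos _)).symm

lemma iidSource_pos (hpos : ∀ a, 0 < p a) {k : ℕ} (w : Word m k) : 0 < iidSource p k w :=
  Finset.prod_pos fun _ _ => hpos _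

lemma mem_typicalSet_iff (hpos : ∀ a, 0 < p a) {H ε : ℝ} {k : ℕ} {w : Word m k} :
    w ∈ typicalSet (iidSource p) H ε k ↔
      k * (H - ε) ≤ ∑ i, -Real.log (p (w i)) ∧ ∑ i, -Real.log (p (w i)) ≤ k * (H + ε) := by
  rw [typicalSet, Finset.mem_filter, iidSource_eq_exp hpos, Real.exp_le_exp, Real.exp_le_exp]
  constructor
  · rintro ⟨-, h1, h2⟩; constructor <;> linarith
  · rintro ⟨h1, h2⟩; refine ⟨Finset.mem_univ _, ?_, ?_⟩ <;> linarith

lemma crossEntropy_eq_sum (l : Fin m → ℝ) : crossEntropy p l = ∑ a, l a * -Real.log (p a) := by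
  simp [crossEntropy]

/-- Change of measure: the words whose `p`- and `l`-information are both near their means have
`l`-mass at least 1/2, and on them P(w)^β exceeds l(w) by the stated exponential factor. The strict
inequalities leave room for the fluctuations. -/
lemma eventually_le_typicalSum (hpos : ∀ a, 0 < p a) {l : Fin m → ℝ}
    (hl : l ∈ stdSimplex ℝ (Fin m)) (hlpos : ∀ a, 0 < l a) {H ε : ℝ}
    (h1 : H - ε < crossEntropy p l) (h2 : crossEntropy p l < H + ε) (β : ℝ) {δ : ℝ}
    (hδ : 0 < δ) :
    ∀ᶠ k : ℕ in atTop, Real.exp (k * (shannonEntropy l - β * crossEntropy p l - δ)) / 2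
      ≤ typicalSum p H ε β k := by
  obtain ⟨η, hη, hη1, hη2, hη3⟩ : ∃ η > 0, η ≤ crossEntropy p l - (H - ε) ∧
      η ≤ H + ε - crossEntropy p l ∧ (1 + |β|) * η ≤ δ := by
    refine ⟨min (min (crossEntropy p l - (H - ε)) (H + ε - crossEntropy p l)) (δ / (1 + |β|)),
      lt_min (lt_min (by linarith) (by linarith)) (by positivity),
      (min_le_left _ _).trans (min_le_left _ _), (min_le_left _ _).trans (min_le_right _ _), ?_⟩
    calc _ ≤ (1 + |β|) * (δ / (1 + |β|)) := by gcongr; exact min_le_right _ _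
      _ = δ := by field_simp
  filter_upwards [eventually_half_le_mass hl (fun a => -Real.log (p a))
    (fun a => -Real.log (l a)) hη] with k hk
  rw [← crossEntropy_eq_sum, ← crossEntropy_eq_sum] at hk
  change _ ≤ ∑ w : Word m k with _ ∧ |_ - k * shannonEntropy l| ≤ _, _ at hk
  rw [div_eq_mul_one_div]
  refine (mul_le_mul_of_nonneg_left hk (Real.exp_pos _).le).trans ?_
  rw [Finset.mul_sum]
  have hk0 : (0 : ℝ) ≤ k := k.cast_nonneg
  have key : ∀ w : Word m k, |∑ i, -Real.log (p (w i)) - k * crossEntropy p l| ≤ k * η ∧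
      |∑ i, -Real.log (l (w i)) - k * shannonEntropy l| ≤ k * η →
      w ∈ typicalSet (iidSource p) H ε k ∧
      Real.exp (k * (shannonEntropy l - β * crossEntropy p l - δ)) * ∏ i, l (w i)
        ≤ iidSource p k w ^ β := by
    rintro w ⟨hp', hl'⟩
    rw [mem_typicalSet_iff hpos]
    have hp'' := abs_le.1 hp'
    rw [abs_le] at hl'
    have e1 := mul_le_mul_of_nonneg_left hη1 hk0
    have e2 := mul_le_mul_of_nonneg_left hη2 hk0
    have e3 := mul_le_mul_of_nonneg_left hη3 hk0
    refine ⟨⟨by linarith [hp''.1], by linarith [hp''.2]⟩, ?_⟩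
    change _ * iidSource l k w ≤ _
    rw [iidSource_eq_exp hpos, iidSource_eq_exp hlpos, ← Real.exp_mul, ← Real.exp_add,
      Real.exp_le_exp]
    have e4 : β * (∑ i, -Real.log (p (w i)) - k * crossEntropy p l) ≤ |β| * (k * η) := by
      refine (le_abs_self _).trans ?_
      rw [abs_mul]
      gcongr
    linarith [hl'.1]
  refine (Finset.sum_le_sum fun w hw => (key w (Finset.mem_filter.1 hw).2).2).trans ?_
  refine Finset.sum_le_sum_of_subset_of_nonneg
    (fun w hw => (key w (Finset.mem_filter.1 hw).2).1) fun w _ _ => ?_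
  exact Real.rpow_nonneg (iidSource_pos hpos w).le _

/-- Chernoff bound: on the typical set P^β ≤ P^θ exp(k(θ - β)c) if `c` is the end of the window that
the sign of θ - β makes extremal. The sum of P^θ over all words factorizes into Z^k. -/
lemma typicalSum_le (hp : p ∈ stdSimplex ℝ (Fin m)) (hpos : ∀ a, 0 < p a) {H ε β θ c : ℝ}
    (h1 : β < θ → c = H + ε) (h2 : θ < β → c = H - ε) (k : ℕ) :
    typicalSum p H ε β k ≤ Real.exp (k * (Real.log (∑ b, p b ^ θ) + (θ - β) * c)) := by
  have hsum : Real.exp (k * Real.log (∑ b, p b ^ θ)) = ∑ w : Word m k, iidSource p k w ^ θ := by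
    rw [mul_comm, Real.exp_mul, Real.exp_log (partition_pos hp hpos θ), Real.rpow_natCast,
      ← sum_iid_mul]
    exact Finset.sum_congr rfl fun w _ =>
      Real.finsetProd_rpow _ _ (fun i _ => (hpos _).le) _
  rw [mul_add, Real.exp_add, hsum, Finset.sum_mul]
  refine (Finset.sum_le_sum fun w hw => ?_).trans
    (Finset.sum_le_sum_of_subset_of_nonneg (Finset.subset_univ _) fun w _ _ =>
      mul_nonneg (Real.rpow_nonneg (iidSource_pos hpos w).le _) (Real.exp_pos _).le)
  rw [mem_typicalSet_iff hpos] at hw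
  rw [iidSource_eq_exp hpos, ← Real.exp_mul, ← Real.exp_mul, ← Real.exp_add, Real.exp_le_exp]
  have : 0 ≤ (θ - β) * (k * c - ∑ i, -Real.log (p (w i))) := by
    rcases lt_trichotomy β θ with h | h | h
    · rw [h1 h]; exact mul_nonneg (by linarith) (by linarith [hw.2])
    · simp [h]
    · rw [h2 h]; exact mul_nonneg_of_nonpos_of_nonpos (by linarith) (by linarith [hw.1])
  linarith

/-- The exponential growth rate of `∑ P(w) ^ β` over the typical set. The Gibbs parameter `θ` is
`β` if the Gibbs distribution of parameter `β` meets the constraint, and otherwise the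
parameter that puts the cross entropy on the nearer end of the interval. -/
lemma tendsto_log_typicalSum (hp : p ∈ stdSimplex ℝ (Fin m)) (hpos : ∀ a, 0 < p a)
    {ε β θ : ℝ} (hε : 0 < ε)
    (hlo : shannonEntropy p - ε ≤ crossEntropy p (gibbs p θ))
    (hhi : crossEntropy p (gibbs p θ) ≤ shannonEntropy p + ε)
    (h1 : β < θ → crossEntropy p (gibbs p θ) = shannonEntropy p + ε)
    (h2 : θ < β → crossEntropy p (gibbs p θ) = shannonEntropy p - ε) :
    (∀ᶠ k : ℕ in atTop, 0 < typicalSum p (shannonEntropy p) ε β k) ∧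
    Tendsto (fun k : ℕ => 1 / (k : ℝ) * Real.log (typicalSum p (shannonEntropy p) ε β k)) atTop
      (𝓝 (shannonEntropy (gibbs p θ) - β * crossEntropy p (gibbs p θ))) := by
  set H := shannonEntropy p with hH
  set c := crossEntropy p (gibbs p θ) with hc
  have hlower : ∀ x < shannonEntropy (gibbs p θ) - β * c, ∃ x' > x,
      ∀ᶠ k : ℕ in atTop, Real.exp (k * x') / 2 ≤ typicalSum p H ε β k := by
    intro x hx
    -- The Gibbs distribution may sit on an end of the window; mixing in a little of `p`, whose
    -- cross entropy is the centre, moves it strictly inside at a small cost.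
    let q : ℝ → Fin m → ℝ := fun s a => (1 - s) * gibbs p θ a + s * p a
    have hq0 : q 0 = gibbs p θ := by ext; simp [q]
    have hcq : ∀ s, crossEntropy p (q s) = (1 - s) * c + s * H := by
      intro s
      have hHc : H = crossEntropy p p := rfl
      simp only [hc, hHc, crossEntropy, q, add_mul, Finset.sum_add_distrib, mul_assoc,
        ← Finset.mul_sum]
      ring
    have hcont : Continuous fun s => shannonEntropy (q s) - β * crossEntropy p (q s) := by
      simp only [hcq]
      refine Continuous.sub ?_ (by fun_prop)
      refine (continuous_finsetSum _ fun a _ => ?_).neg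
      exact Real.continuous_mul_log.comp (by fun_prop : Continuous fun s => q s a)
    have hx0 : x < shannonEntropy (q 0) - β * crossEntropy p (q 0) := by
      rwa [hq0]
    have hnear : ∀ᶠ s in 𝓝[>] (0 : ℝ),
        x < shannonEntropy (q s) - β * crossEntropy p (q s) :=
      nhdsWithin_le_nhds (hcont.continuousAt.eventually_const_lt hx0)
    obtain ⟨s, hs, hs0, hs1⟩ := (hnear.and (Ioo_mem_nhdsGT one_pos)).exists
    have hqpos : ∀ a, 0 < q s a := fun a =>
      add_pos (mul_pos (by linarith) (gibbs_pos hp hpos θ a)) (mul_pos hs0 (hpos a))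
    have hqmem : q s ∈ stdSimplex ℝ (Fin m) := by
      refine ⟨fun a => (hqpos a).le, ?_⟩
      simp only [q, Finset.sum_add_distrib, ← Finset.mul_sum, (gibbs_mem hp hpos θ).2, hp.2]
      ring
    refine ⟨_, by linarith, eventually_le_typicalSum (H := H) (ε := ε) hpos hqmem hqpos
      (by rw [hcq]; nlinarith) (by rw [hcq]; nlinarith) β (half_pos (sub_pos.2 hs))⟩
  have hposev : ∀ᶠ k : ℕ in atTop, 0 < typicalSum p H ε β k := by
    obtain ⟨x', -, h⟩ := hlower _ (sub_one_lt _)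
    filter_upwards [h] with k hk
    exact (by positivity : (0 : ℝ) < Real.exp (k * x') / 2).trans_le hk
  refine ⟨hposev, tendsto_order.2 ⟨fun x hx => ?_, fun x hx => ?_⟩⟩
  -- The gap x' - x absorbs the factor 1/2 once k exceeds log 2 / (x' - x).
  · obtain ⟨x', hx', h⟩ := hlower x hx
    filter_upwards [h, eventually_gt_atTop 0, tendsto_natCast_atTop_atTop.eventually_gt_atTop
      (Real.log 2 / (x' - x))] with k hk hk0 hkx
    have hk0' : (0 : ℝ) < k := by exact_mod_cast hk0
    have := Real.log_le_log (by positivity) hk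
    rw [Real.log_div (Real.exp_pos _).ne' two_ne_zero, Real.log_exp] at this
    rw [div_lt_iff₀ (sub_pos.2 hx')] at hkx
    rw [one_div, lt_inv_mul_iff₀ hk0']
    linarith
  · filter_upwards [hposev, eventually_gt_atTop 0] with k hk hk0
    have hk0' : (0 : ℝ) < k := by exact_mod_cast hk0
    refine lt_of_le_of_lt ?_ hx
    rw [one_div, inv_mul_le_iff₀ hk0', ← Real.log_exp (k * _)]
    refine Real.log_le_log hk ((typicalSum_le hp hpos h1 h2 k).trans_eq ?_)
    rw [shannonEntropy_gibbs hp hpos]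
    congr 1
    ring

end Typical

/-! ### Moments of Guesswork against power sums -/

section GuessworkMoments

variable {m k : ℕ} {P : Word m k → ℝ} {G : Word m k → ℕ}

lemma IsGuesswork.one_le (hG : IsGuesswork P G) (w : Word m k) : 1 ≤ G w :=
  (hG.1.mapsTo (Set.mem_univ w)).1

/-- Every word guessed no later than `w` is at least as likely as `w`. -/
lemma IsGuesswork.le_card (hG : IsGuesswork P G) (w : Word m k) :
    G w ≤ (Finset.univ.filter fun v => P w ≤ P v).card := by
  have hsub : Finset.Icc 1 (G w) ⊆ (Finset.univ.filter fun v => P w ≤ P v).image G := by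
    intro n hn
    rw [Finset.mem_Icc] at hn
    obtain ⟨v, -, rfl⟩ := hG.1.surjOn
      (⟨hn.1, hn.2.trans (hG.1.mapsTo (Set.mem_univ w)).2⟩ : n ∈ Set.Icc 1 (m ^ k))
    refine Finset.mem_image_of_mem _ (Finset.mem_filter.2 ⟨Finset.mem_univ _, ?_⟩)
    by_contra! h
    exact absurd (hG.2 _ _ h) (not_lt.2 hn.2)
  simpa using (Finset.card_le_card hsub).trans Finset.card_image_le

lemma IsGuesswork.le_sum_rpow_div (hG : IsGuesswork P G) (hP : ∀ w, 0 ≤ P w) {β : ℝ}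
    (hβ : 0 ≤ β) {w : Word m k} (hw : 0 < P w) :
    (G w : ℝ) ≤ (∑ v, P v ^ β) / P w ^ β := by
  rw [le_div_iff₀ (Real.rpow_pos_of_pos hw _)]
  calc (G w : ℝ) * P w ^ β ≤ ((Finset.univ.filter fun v => P w ≤ P v).card : ℝ) * P w ^ β := by
        gcongr
        exact_mod_cast hG.le_card w
    _ = ∑ v with P w ≤ P v, P w ^ β := by simp
    _ ≤ ∑ v with P w ≤ P v, P v ^ β :=
        Finset.sum_le_sum fun v hv => Real.rpow_le_rpow hw.le (Finset.mem_filter.1 hv).2 hβ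
    _ ≤ ∑ v, P v ^ β := Finset.sum_le_sum_of_subset_of_nonneg (Finset.filter_subset _ _)
        fun v _ _ => Real.rpow_nonneg (hP v) _

lemma IsGuesswork.sum_inv_le (hG : IsGuesswork P G) :
    ∑ w, (G w : ℝ)⁻¹ ≤ 1 + k * Real.log m := by
  have h : ∑ w, (G w : ℝ)⁻¹ = ∑ n ∈ Finset.Icc 1 (m ^ k), (n : ℝ)⁻¹ := by
    refine Finset.sum_bij (fun w _ => G w) (fun w _ => ?_) (fun w _ v _ h => ?_)
      (fun n hn => ?_) fun _ _ => rfl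
    · exact Finset.mem_Icc.2 (hG.1.mapsTo (Set.mem_univ w))
    · exact hG.1.injOn (Set.mem_univ _) (Set.mem_univ _) h
    · obtain ⟨w, -, rfl⟩ := hG.1.surjOn (Finset.mem_Icc.1 hn : n ∈ Set.Icc 1 (m ^ k))
      exact ⟨w, Finset.mem_univ _, rfl⟩
  have := harmonic_le_one_add_log (m ^ k)
  rw [harmonic_eq_sum_Icc] at this
  push_cast at this
  rwa [h, ← Real.log_pow]

lemma exp_mul_log_natCast (hG : IsGuesswork P G) (α : ℝ) (w : Word m k) :
    Real.exp (α * Real.log (G w : ℝ)) = (G w : ℝ) ^ α := by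
  rw [Real.rpow_def_of_pos (by exact_mod_cast hG.one_le w), mul_comm]

/-- The generalized moments of Guesswork agree with a power of `∑ P ^ (1 / (1 + α))` up to a
power of `∑ 1 / G`. -/
lemma IsGuesswork.abs_log_moment_sub_le (hG : IsGuesswork P G) (hP : ∀ w, 0 ≤ P w) {α : ℝ}
    (hα : -1 < α) (hS : 0 < ∑ w, P w ^ (1 / (1 + α))) :
    |Real.log (∑ w, P w * Real.exp (α * Real.log (G w : ℝ)))
      - (1 + α) * Real.log (∑ w, P w ^ (1 / (1 + α)))| ≤ |α| * Real.log (1 + k * Real.log m) := by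
  have hα' : 0 < 1 + α := by linarith
  simp only [exp_mul_log_natCast hG]
  set β := 1 / (1 + α) with hβdef
  have hβ : 0 < β := by positivity
  set S := ∑ w, P w ^ β with hSdef
  set E := ∑ w, P w * (G w : ℝ) ^ α with hEdef
  set L := ∑ w, (G w : ℝ)⁻¹ with hLdef
  have hGpos : ∀ w, (0 : ℝ) < G w := fun w => by exact_mod_cast hG.one_le w
  obtain ⟨w₀, -, hw₀⟩ := Finset.exists_lt_of_sum_lt (s := Finset.univ) (f := fun _ : Word m k => 0)
    (g := fun w => P w ^ β) (by simpa using hS)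
  have hPw₀ : 0 < P w₀ := by
    refine (hP w₀).lt_of_ne fun h => ?_
    rw [← h, Real.zero_rpow hβ.ne'] at hw₀
    exact lt_irrefl _ hw₀
  have hE : 0 < E := Finset.sum_pos' (fun w _ => mul_nonneg (hP w) (Real.rpow_nonneg (hGpos w).le _))
    ⟨w₀, Finset.mem_univ _, mul_pos hPw₀ (Real.rpow_pos_of_pos (hGpos _) _)⟩
  have hL : 0 < L := Finset.sum_pos (fun w _ => inv_pos.2 (hGpos w)) ⟨w₀, Finset.mem_univ _⟩
  have hLlog : Real.log L ≤ Real.log (1 + k * Real.log m) := Real.log_le_log hL hG.sum_inv_le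
  have hαβ : 1 - α * β = β := by rw [hβdef]; field_simp; ring
  have hβα : β * (1 + α) = 1 := by rw [hβdef]; field_simp
  -- Substituting the bound S / P^β for G turns P G^α into S^α P^β, since 1 - αβ = β.
  have hpt : ∀ w, 0 < P w → P w * (S / P w ^ β) ^ α = S ^ α * P w ^ β := by
    intro w hw
    rw [Real.div_rpow hS.le (Real.rpow_nonneg hw.le _), ← Real.rpow_mul hw.le, mul_comm β,
      mul_div_left_comm]
    congr 1
    nth_rewrite 1 [← Real.rpow_one (P w)]
    rw [← Real.rpow_sub hw, hαβ]
  have hSS : ∑ w, S ^ α * P w ^ β = S ^ (1 + α) := by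
    rw [← Finset.mul_sum, ← hSdef, add_comm, Real.rpow_add_one hS.ne']
  have hlogS : Real.log (S ^ (1 + α)) = (1 + α) * Real.log S := Real.log_rpow hS _
  rcases lt_trichotomy α 0 with hneg | rfl | hposα
  -- For negative α the bound on G reverses under the power, so it bounds the moment from below and
  -- Hölder bounds it from above; for positive α the roles swap.
  · have hlow : S ^ (1 + α) ≤ E := by
      rw [← hSS]
      refine Finset.sum_le_sum fun w _ => ?_
      rcases (hP w).eq_or_lt with h | h
      · simp [← h, Real.zero_rpow hβ.ne']
      · rw [← hpt w h]
        exact mul_le_mul_of_nonneg_left (Real.rpow_le_rpow_of_nonpos (hGpos w)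
          (hG.le_sum_rpow_div hP hβ.le h) hneg.le) h.le
    have hup : E ≤ S ^ (1 + α) * L ^ (-α) := by
      have hc : (1 / (1 + α)).HolderConjugate (1 / (-α)) := by
        rw [Real.holderConjugate_iff]
        refine ⟨by rw [lt_div_iff₀ hα']; linarith, ?_⟩
        simp
      have := Real.inner_le_Lp_mul_Lq_of_nonneg Finset.univ hc (f := P)
        (g := fun w => (G w : ℝ) ^ α) (fun w _ => hP w) fun w _ => Real.rpow_nonneg (hGpos w).le _
      simp only [one_div_one_div] at this
      convert this using 3
      refine Finset.sum_congr rfl fun w _ => ?_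
      rw [← Real.rpow_mul (hGpos w).le, ← Real.rpow_neg_one]
      congr 1
      have := hneg.ne
      field_simp
    have a1 := Real.log_le_log (Real.rpow_pos_of_pos hS _) hlow
    have a2 := Real.log_le_log hE hup
    rw [Real.log_mul (Real.rpow_pos_of_pos hS _).ne' (Real.rpow_pos_of_pos hL _).ne',
      Real.log_rpow hL, hlogS] at a2
    rw [hlogS] at a1
    rw [abs_of_nonneg (by linarith), abs_of_neg hneg]
    nlinarith
  · simp [E, S, β]
  · have hup : E ≤ S ^ (1 + α) := by
      rw [← hSS]
      refine Finset.sum_le_sum fun w _ => ?_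
      rcases (hP w).eq_or_lt with h | h
      · simp [← h, Real.zero_rpow hβ.ne']
      · rw [← hpt w h]
        exact mul_le_mul_of_nonneg_left (Real.rpow_le_rpow (hGpos w).le
          (hG.le_sum_rpow_div hP hβ.le h) hposα.le) h.le
    -- Hölder with exponents 1 + α and (1 + α)/α, applied to P^β = (P^β G^(αβ)) · G^(-αβ).
    have hlow : S ≤ E ^ β * L ^ (α * β) := by
      have hc : (1 + α).HolderConjugate (1 / (α * β)) := by
        rw [Real.holderConjugate_iff]
        refine ⟨by linarith, ?_⟩
        rw [one_div, inv_inv, ← one_div, ← hβdef]; linarith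
      have := Real.inner_le_Lp_mul_Lq_of_nonneg Finset.univ hc
        (f := fun w => P w ^ β * (G w : ℝ) ^ (α * β)) (g := fun w => (G w : ℝ) ^ (-(α * β)))
        (fun w _ => mul_nonneg (Real.rpow_nonneg (hP w) _) (Real.rpow_nonneg (hGpos w).le _))
        fun w _ => Real.rpow_nonneg (hGpos w).le _
      simp only [one_div_one_div] at this
      convert this using 3
      · rw [mul_assoc, ← Real.rpow_add (hGpos _), add_neg_cancel, Real.rpow_zero, mul_one]
      · refine Finset.sum_congr rfl fun w _ => ?_
        rw [Real.mul_rpow (Real.rpow_nonneg (hP w) _) (Real.rpow_nonneg (hGpos w).le _),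
          ← Real.rpow_mul (hP w), ← Real.rpow_mul (hGpos w).le, mul_assoc, hβα, mul_one,
          Real.rpow_one]
      · refine Finset.sum_congr rfl fun w _ => ?_
        rw [← Real.rpow_mul (hGpos w).le, ← Real.rpow_neg_one]
        congr 1
        field_simp
    have a1 := Real.log_le_log hS hlow
    have a2 := Real.log_le_log hE hup
    rw [Real.log_mul (Real.rpow_pos_of_pos hE _).ne' (Real.rpow_pos_of_pos hL _).ne',
      Real.log_rpow hL, Real.log_rpow hE] at a1
    rw [hlogS] at a2
    have a3 : (1 + α) * Real.log S ≤ Real.log E + α * Real.log L := by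
      calc _ ≤ (1 + α) * (β * Real.log E + α * β * Real.log L) := by gcongr
        _ = (β * (1 + α)) * (Real.log E + α * Real.log L) := by ring
        _ = _ := by rw [hβα, one_mul]
    rw [abs_of_nonpos (by linarith), abs_of_pos hposα]
    nlinarith

end GuessworkMoments

/-! ### Passage to the limit, and differentiability from subgradients -/

lemma tendsto_inv_mul_log_one_add {c : ℝ} (hc : 0 ≤ c) :
    Tendsto (fun k : ℕ => 1 / (k : ℝ) * Real.log (1 + k * c)) atTop (𝓝 0) := by
  have h1 : Tendsto (fun k : ℕ => Real.log k / (k : ℝ)) atTop (𝓝 0) :=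
    Real.isLittleO_log_id_atTop.tendsto_div_nhds_zero.comp tendsto_natCast_atTop_atTop
  have h2 := (tendsto_one_div_atTop_nhds_zero_nat.mul_const (Real.log (1 + c))).add h1
  rw [zero_mul, zero_add] at h2
  refine squeeze_zero' (Eventually.of_forall fun k => ?_) ?_ h2
  · have : (0 : ℝ) ≤ k * c := by positivity
    exact mul_nonneg (by positivity) (Real.log_nonneg (by linarith))
  · filter_upwards [eventually_gt_atTop 0] with k hk
    have hk1 : (1 : ℝ) ≤ k := by exact_mod_cast hk
    have hk0 : (0 : ℝ) < k := by linarith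
    calc 1 / (k : ℝ) * Real.log (1 + k * c)
        ≤ 1 / (k : ℝ) * Real.log ((1 + c) * k) := by
          gcongr
          linarith
      _ = _ := by rw [Real.log_mul (by positivity) hk0.ne']; ring

lemma hasSCGF_of_tendsto {m : ℕ} {Q : Source m} {G : (k : ℕ) → Word m k → ℕ}
    (hG : ∀ k, IsGuesswork (Q k) (G k)) (hQ : ∀ k w, 0 ≤ Q k w) {α r : ℝ} (hα : -1 < α)
    (hS : ∀ᶠ k in atTop, 0 < ∑ w, Q k w ^ (1 / (1 + α)))
    (hr : Tendsto (fun k : ℕ => 1 / (k : ℝ) * Real.log (∑ w, Q k w ^ (1 / (1 + α)))) atTop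
      (𝓝 r)) : HasSCGF Q G α ((1 + α) * r) := by
  have hz := (tendsto_inv_mul_log_one_add (Real.log_natCast_nonneg m)).const_mul |α|
  rw [mul_zero] at hz
  have hd := squeeze_zero_norm' (f := fun k : ℕ => 1 / (k : ℝ) *
    Real.log (∑ w, Q k w * Real.exp (α * Real.log (G k w : ℝ)))
      - (1 + α) * (1 / (k : ℝ) * Real.log (∑ w, Q k w ^ (1 / (1 + α))))) ?_ hz
  · have := hd.add (hr.const_mul (1 + α))
    simp only [sub_add_cancel, zero_add] at this
    exact this
  · filter_upwards [hS] with k hk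
    have h := (hG k).abs_log_moment_sub_le (hQ k) hα hk
    rw [mul_left_comm (1 + α), ← mul_sub, norm_mul, Real.norm_eq_abs, Real.norm_eq_abs,
      abs_of_nonneg (by positivity : (0 : ℝ) ≤ 1 / k), mul_left_comm |α|]
    gcongr

/-- Envelope theorem: a function with continuous selection of subgradients is differentiable. -/
lemma hasDerivAt_of_subgradient {s : Set ℝ} (hs : IsOpen s) {Λ ψ : ℝ → ℝ}
    (h : ∀ x ∈ s, ∀ y ∈ s, (y - x) * ψ x ≤ Λ y - Λ x) (hψ : ContinuousOn ψ s) {x : ℝ}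
    (hx : x ∈ s) : HasDerivAt Λ (ψ x) x := by
  rw [hasDerivAt_iff_isLittleO, Asymptotics.isLittleO_iff]
  intro c hc
  have hcont := (hψ.continuousAt (hs.mem_nhds hx)).eventually (Metric.ball_mem_nhds _ hc)
  filter_upwards [hs.mem_nhds hx, hcont] with y hy hyc
  -- The subgradient inequalities at x and at y squeeze the remainder between 0 and (y - x)(ψ y - ψ
  -- x).
  have h1 := h x hx y hy
  have h2 := h y hy x hx
  replace hyc : |ψ y - ψ x| < c := hyc
  rw [Real.norm_eq_abs, Real.norm_eq_abs, smul_eq_mul, abs_of_nonneg (by linarith)]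
  calc Λ y - Λ x - (y - x) * ψ x ≤ (y - x) * (ψ y - ψ x) := by linarith
    _ ≤ |y - x| * |ψ y - ψ x| := by rw [← abs_mul]; exact le_abs_self _
    _ ≤ |y - x| * c := by gcongr
    _ = c * |y - x| := mul_comm _ _

lemma shannonEntropy_iidSource {m : ℕ} {p : Fin m → ℝ} (hp : p ∈ stdSimplex ℝ (Fin m))
    (hpos : ∀ a, 0 < p a) (k : ℕ) : shannonEntropy (iidSource p k) = k * shannonEntropy p := by
  rw [shannonEntropy, shannonEntropy, mul_neg, ← sum_iid_mul_sum hp.2]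
  congr 1
  refine Finset.sum_congr rfl fun w _ => ?_
  rw [iidSource, Real.log_prod fun i _ => (hpos _).ne']

lemma HasSpecificEntropy.eq_of_iid {m : ℕ} {p : Fin m → ℝ} (hp : p ∈ stdSimplex ℝ (Fin m))
    (hpos : ∀ a, 0 < p a) {H : ℝ} (h : HasSpecificEntropy (iidSource p) H) :
    H = shannonEntropy p := by
  refine tendsto_nhds_unique h (tendsto_const_nhds.congr' ?_)
  filter_upwards [eventually_gt_atTop 0] with k hk
  have : (k : ℝ) ≠ 0 := by exact_mod_cast hk.ne'
  rw [shannonEntropy_iidSource hp hpos]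
  field_simp

/-! ### The uniform source -/

section Uniform

variable {m : ℕ} {Q : Source m} {H ε : ℝ} {k : ℕ}

lemma sum_uniformSource_rpow {β : ℝ} (hβ : 0 < β) (h : 0 < (typicalSet Q H ε k).card) :
    ∑ w, uniformSource Q H ε k w ^ β = ((typicalSet Q H ε k).card : ℝ) ^ (1 - β) := by
  have hN : (0 : ℝ) < (typicalSet Q H ε k).card := by exact_mod_cast h
  have : ∀ w, uniformSource Q H ε k w ^ β = if w ∈ typicalSet Q H ε k then
      (1 / ((typicalSet Q H ε k).card : ℝ)) ^ β else 0 := fun w => by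
    unfold uniformSource
    split_ifs <;> simp [hβ.ne']
  simp only [this, Finset.sum_ite_mem, Finset.univ_inter, Finset.sum_const, nsmul_eq_mul]
  rw [one_div, Real.inv_rpow hN.le, Real.rpow_sub hN, Real.rpow_one, div_eq_mul_inv]

lemma renyiEntropy_uniformSource {β : ℝ} (hβ : 0 < β) (h : 0 < (typicalSet Q H ε k).card) :
    renyiEntropy β (uniformSource Q H ε k) = Real.log (typicalSet Q H ε k).card := by
  have hN : (0 : ℝ) < (typicalSet Q H ε k).card := by exact_mod_cast h
  rw [renyiEntropy]
  split_ifs with h1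
  · have : ∀ w, uniformSource Q H ε k w * Real.log (uniformSource Q H ε k w)
        = if w ∈ typicalSet Q H ε k then (1 / ((typicalSet Q H ε k).card : ℝ))
          * Real.log (1 / ((typicalSet Q H ε k).card : ℝ)) else 0 := fun w => by
      unfold uniformSource
      split_ifs <;> simp
    simp only [shannonEntropy, this, Finset.sum_ite_mem, Finset.univ_inter, Finset.sum_const,
      nsmul_eq_mul, one_div, Real.log_inv]
    field_simp
  · rw [sum_uniformSource_rpow hβ h, Real.log_rpow hN]
    have : 1 - β ≠ 0 := fun h => h1 (by linarith)
    field_simp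

lemma uniformSource_nonneg (w : Word m k) : 0 ≤ uniformSource Q H ε k w := by
  unfold uniformSource
  split_ifs <;> positivity

lemma typicalSum_zero (p : Fin m → ℝ) :
    typicalSum p H ε 0 k = (typicalSet (iidSource p) H ε k).card := by
  simp [typicalSum]

end Uniform

/-- All Rényi entropies of a uniform law equal the log of its support size, so Λ is linear in α. -/
lemma regularSCGF_uniformSource {m : ℕ} {p : Fin m → ℝ} {H ε M : ℝ}
    {G : (k : ℕ) → Word m k → ℕ} (hG : ∀ k, IsGuesswork (uniformSource (iidSource p) H ε k) (G k))
    (hpos : ∀ᶠ k in atTop, 0 < typicalSum p H ε 0 k)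
    (hlim : Tendsto (fun k : ℕ => 1 / (k : ℝ) * Real.log (typicalSum p H ε 0 k)) atTop (𝓝 M)) :
    RegularSCGF (uniformSource (iidSource p) H ε) G fun α => α * M := by
  simp only [typicalSum_zero, Nat.cast_pos] at hpos hlim
  refine ⟨fun α hα => ?_, fun α hα => ⟨M, ?_, rfl⟩,
    fun _ => M, continuousOn_const, fun α _ => hasDerivAt_mul_const M⟩ <;>
    have hα' : 0 < 1 + α := by linarith
  · convert hasSCGF_of_tendsto hG (fun k w => uniformSource_nonneg w) hα
      (r := (1 - 1 / (1 + α)) * M) ?_ ?_ using 1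
    · field_simp; ring
    · filter_upwards [hpos] with k hk
      rw [sum_uniformSource_rpow (by positivity) hk]
      positivity
    · refine (hlim.const_mul _).congr' ?_
      filter_upwards [hpos] with k hk
      rw [sum_uniformSource_rpow (by positivity) hk, Real.log_rpow (by exact_mod_cast hk),
        mul_left_comm]
  · refine hlim.congr' ?_
    filter_upwards [hpos] with k hk
    rw [renyiEntropy_uniformSource (by positivity) hk]

/-! ### The conditioned source -/

section Conditioned

variable {m : ℕ} {p : Fin m → ℝ}

lemma conditionedSource_apply {H ε : ℝ} {k : ℕ} (w : Word m k) :
    conditionedSource (iidSource p) H ε k w = if w ∈ typicalSet (iidSource p) H ε k then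
      iidSource p k w / typicalSum p H ε 1 k else 0 := by
  simp only [conditionedSource, typicalSum, Real.rpow_one]

lemma typicalSum_nonneg (hpos : ∀ a, 0 < p a) (H ε β : ℝ) (k : ℕ) :
    0 ≤ typicalSum p H ε β k :=
  Finset.sum_nonneg fun w _ => Real.rpow_nonneg (iidSource_pos hpos w).le _

lemma conditionedSource_nonneg (hpos : ∀ a, 0 < p a) {H ε : ℝ} {k : ℕ} (w : Word m k) :
    0 ≤ conditionedSource (iidSource p) H ε k w := by
  rw [conditionedSource_apply]
  split_ifs
  · exact div_nonneg (iidSource_pos hpos w).le (typicalSum_nonneg hpos _ _ _ _)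
  · exact le_rfl

lemma sum_conditionedSource_rpow (hpos : ∀ a, 0 < p a) {H ε β : ℝ} (hβ : 0 < β) (k : ℕ) :
    ∑ w, conditionedSource (iidSource p) H ε k w ^ β
      = typicalSum p H ε β k / typicalSum p H ε 1 k ^ β := by
  have : ∀ w, conditionedSource (iidSource p) H ε k w ^ β
      = if w ∈ typicalSet (iidSource p) H ε k then
        iidSource p k w ^ β / typicalSum p H ε 1 k ^ β else 0 := fun w => by
    rw [conditionedSource_apply]
    split_ifs
    · rw [Real.div_rpow (iidSource_pos hpos w).le (typicalSum_nonneg hpos _ _ _ _)]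
    · exact Real.zero_rpow hβ.ne'
  simp only [this, Finset.sum_ite_mem, Finset.univ_inter, ← Finset.sum_div]
  rfl

lemma eventually_half_le_typicalSum_one (hp : p ∈ stdSimplex ℝ (Fin m)) (hpos : ∀ a, 0 < p a)
    {ε : ℝ} (hε : 0 < ε) :
    ∀ᶠ k : ℕ in atTop, 1 / 2 ≤ typicalSum p (shannonEntropy p) ε 1 k := by
  filter_upwards [eventually_half_le_mass hp (fun a => -Real.log (p a))
    (fun a => -Real.log (p a)) hε] with k hk
  rw [← crossEntropy_eq_sum] at hk
  change _ ≤ ∑ w : Word m k with |_ - k * shannonEntropy p| ≤ _ ∧ _, iidSource p k w at hk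
  refine hk.trans ?_
  simp only [typicalSum, Real.rpow_one]
  refine Finset.sum_le_sum_of_subset_of_nonneg (fun w hw => ?_)
    fun w _ _ => (iidSource_pos hpos w).le
  have := abs_le.1 (Finset.mem_filter.1 hw).2.1
  rw [mem_typicalSet_iff hpos]
  constructor <;> linarith [this.1, this.2]

lemma tendsto_log_typicalSum_one (hp : p ∈ stdSimplex ℝ (Fin m)) (hpos : ∀ a, 0 < p a)
    {ε : ℝ} (hε : 0 < ε) :
    Tendsto (fun k : ℕ => 1 / (k : ℝ) * Real.log (typicalSum p (shannonEntropy p) ε 1 k)) atTop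
      (𝓝 0) := by
  have he := crossEntropy_gibbs_one hp
  convert (tendsto_log_typicalSum (β := 1) (θ := 1) hp hpos hε (by linarith) (by linarith)
    (fun h => absurd h (lt_irrefl _)) (fun h => absurd h (lt_irrefl _))).2 using 2
  rw [he, gibbs_one hp]; ring

lemma shannonEntropy_conditionedSource (hpos : ∀ a, 0 < p a) {H ε : ℝ} {k : ℕ}
    (hA : 0 < typicalSum p H ε 1 k) :
    shannonEntropy (conditionedSource (iidSource p) H ε k) = k * H
      + (∑ w ∈ typicalSet (iidSource p) H ε k,
          iidSource p k w * (∑ i, -Real.log (p (w i)) - k * H)) / typicalSum p H ε 1 k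
      + Real.log (typicalSum p H ε 1 k) := by
  set A := typicalSum p H ε 1 k with hAdef
  have hA1 : ∑ w ∈ typicalSet (iidSource p) H ε k, iidSource p k w = A := by
    simp [hAdef, typicalSum]
  have : ∀ w, conditionedSource (iidSource p) H ε k w
      * Real.log (conditionedSource (iidSource p) H ε k w)
      = if w ∈ typicalSet (iidSource p) H ε k then
        -(iidSource p k w * (∑ i, -Real.log (p (w i)) - k * H) / A)
          - iidSource p k w * ((k * H + Real.log A) / A) else 0 := fun w => by
    rw [conditionedSource_apply, ← hAdef]
    split_ifs
    · rw [Real.log_div (iidSource_pos hpos w).ne' hA.ne']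
      nth_rewrite 2 [iidSource_eq_exp hpos]
      rw [Real.log_exp]; ring
    · simp
  simp only [shannonEntropy, this, Finset.sum_ite_mem, Finset.univ_inter, Finset.sum_sub_distrib,
    Finset.sum_neg_distrib, ← Finset.sum_div, ← Finset.sum_mul, hA1]
  field_simp
  ring

/-- Needed at α = 0, where the Rényi order is one and power sums carry no information. The mean
deviation of the information from kH is O(√k) by the second moment, and conditioning at most doubles
it for large k. -/
lemma hasSpecificEntropy_conditionedSource (hp : p ∈ stdSimplex ℝ (Fin m))
    (hpos : ∀ a, 0 < p a) {ε : ℝ} (hε : 0 < ε) :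
    HasSpecificEntropy (conditionedSource (iidSource p) (shannonEntropy p) ε)
      (shannonEntropy p) := by
  set H := shannonEntropy p with hH
  obtain ⟨V, hV, hsq⟩ := exists_second_moment_bound hp fun a => -Real.log (p a)
  rw [← crossEntropy_eq_sum] at hsq
  change ∀ k : ℕ, ∑ w : Word m k, iidSource p k w * (_ - k * H) ^ 2 = _ at hsq
  have hz : Tendsto (fun k : ℕ => 1 / (k : ℝ) * ((∑ w ∈ typicalSet (iidSource p) H ε k,
      iidSource p k w * (∑ i, -Real.log (p (w i)) - k * H)) / typicalSum p H ε 1 k))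
      atTop (𝓝 0) := by
    have hs : Tendsto (fun k : ℕ => (1 + V) / √(k : ℝ)) atTop (𝓝 0) :=
      (Real.tendsto_sqrt_atTop.comp tendsto_natCast_atTop_atTop).const_div_atTop _
    refine squeeze_zero_norm' ?_ hs
    filter_upwards [eventually_half_le_typicalSum_one hp hpos hε, eventually_gt_atTop 0]
      with k hA hk
    have hk0 : (0 : ℝ) < k := by exact_mod_cast hk
    have hs0 : 0 < √(k : ℝ) := Real.sqrt_pos.2 hk0
    have hss : √(k : ℝ) * √(k : ℝ) = k := Real.mul_self_sqrt hk0.le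
    have hbound : |∑ w ∈ typicalSet (iidSource p) H ε k,
        iidSource p k w * (∑ i, -Real.log (p (w i)) - k * H)| ≤ √(k : ℝ) * (1 + V) / 2 := by
      -- The arithmetic-geometric mean inequality |y| ≤ √k/2 + y²/(2√k).
      have hpt : ∀ w : Word m k, |iidSource p k w * (∑ i, -Real.log (p (w i)) - k * H)|
          ≤ iidSource p k w * (√(k : ℝ) / 2)
            + iidSource p k w * (∑ i, -Real.log (p (w i)) - k * H) ^ 2 / (2 * √(k : ℝ)) := by
        intro w
        rw [abs_mul, abs_of_pos (iidSource_pos hpos w), mul_div_assoc, ← mul_add]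
        refine mul_le_mul_of_nonneg_left ?_ (iidSource_pos hpos w).le
        set y := ∑ i, -Real.log (p (w i)) - k * H
        rw [div_add_div _ _ two_ne_zero (by positivity), le_div_iff₀ (by positivity), ← sq_abs y]
        nlinarith [sq_nonneg (√(k : ℝ) - |y|)]
      refine (Finset.abs_sum_le_sum_abs _ _).trans ?_
      refine (Finset.sum_le_sum_of_subset_of_nonneg (Finset.subset_univ _)
        fun w _ _ => abs_nonneg _).trans ((Finset.sum_le_sum fun w _ => hpt w).trans_eq ?_)
      have h1 : ∑ w : Word m k, iidSource p k w = 1 := by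
        have := sum_iid_mul p k
        rwa [hp.2, one_pow] at this
      rw [Finset.sum_add_distrib, ← Finset.sum_mul, ← Finset.sum_div, hsq, h1]
      field_simp
      linear_combination (-V) * hss
    rw [Real.norm_eq_abs, abs_mul, abs_div _ (typicalSum p H ε 1 k),
      abs_of_pos (by positivity : (0 : ℝ) < 1 / k),
      abs_of_pos (by linarith : 0 < typicalSum p H ε 1 k)]
    calc _ ≤ 1 / (k : ℝ) * (√(k : ℝ) * (1 + V) / 2 / (1 / 2)) := by gcongr
      _ = (1 + V) / √(k : ℝ) := by
        field_simp
        linear_combination hss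
  have := ((tendsto_const_nhds (x := H)).add hz).add (tendsto_log_typicalSum_one hp hpos hε)
  rw [add_zero, add_zero] at this
  refine this.congr' ?_
  filter_upwards [eventually_half_le_typicalSum_one hp hpos hε, eventually_gt_atTop 0] with k hA hk
  have hk0 : (k : ℝ) ≠ 0 := by exact_mod_cast hk.ne'
  rw [shannonEntropy_conditionedSource hpos (by linarith), mul_add, mul_add, ← mul_assoc,
    one_div_mul_cancel hk0, one_mul]

/-- The normalizing mass is eventually at least 1/2 and has rate zero, so it drops out of the limit.
-/
lemma tendsto_log_sum_conditionedSource_rpow (hp : p ∈ stdSimplex ℝ (Fin m))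
    (hpos : ∀ a, 0 < p a) {ε β r : ℝ} (hε : 0 < ε) (hβ : 0 < β)
    (hS : ∀ᶠ k in atTop, 0 < typicalSum p (shannonEntropy p) ε β k)
    (hr : Tendsto (fun k : ℕ => 1 / (k : ℝ) *
      Real.log (typicalSum p (shannonEntropy p) ε β k)) atTop (𝓝 r)) :
    (∀ᶠ k in atTop,
      0 < ∑ w, conditionedSource (iidSource p) (shannonEntropy p) ε k w ^ β) ∧
    Tendsto (fun k : ℕ => 1 / (k : ℝ) * Real.log
      (∑ w, conditionedSource (iidSource p) (shannonEntropy p) ε k w ^ β)) atTop (𝓝 r) := by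
  have hA := eventually_half_le_typicalSum_one hp hpos hε
  simp only [sum_conditionedSource_rpow hpos hβ]
  constructor
  · filter_upwards [hS, hA] with k hk hAk
    have : 0 < typicalSum p (shannonEntropy p) ε 1 k := by linarith
    positivity
  · have := hr.sub ((tendsto_log_typicalSum_one hp hpos hε).const_mul β)
    rw [mul_zero, sub_zero] at this
    refine this.congr' ?_
    filter_upwards [hS, hA] with k hk hAk
    have hA0 : 0 < typicalSum p (shannonEntropy p) ε 1 k := by linarith
    rw [Real.log_div hk.ne' (Real.rpow_pos_of_pos hA0 _).ne', Real.log_rpow hA0]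
    ring

end Conditioned

/-! ### The optimizer l* and regularity for the conditioned source -/

section Selection

variable {m : ℕ} {p : Fin m → ℝ}

/-- At θ = 1 the cross entropy is h(p), so monotonicity forces β ≤ 1 and the intermediate value
theorem applies on [β, 1]. -/
lemma exists_gibbs_of_crossEntropy_ge (hp : p ∈ stdSimplex ℝ (Fin m)) (hpos : ∀ a, 0 < p a)
    {ε β : ℝ} (hε : 0 < ε) (h : shannonEntropy p + ε ≤ crossEntropy p (gibbs p β)) :
    ∃ θ, β ≤ θ ∧ crossEntropy p (gibbs p θ) = shannonEntropy p + ε := by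
  have h1 := crossEntropy_gibbs_one hp
  have hβ : β ≤ 1 := by
    by_contra! hlt
    have : crossEntropy p (gibbs p β) ≤ crossEntropy p (gibbs p 1) :=
      crossEntropy_gibbs_antitone hp hpos hlt.le
    linarith
  obtain ⟨θ, hθ, he⟩ := intermediate_value_Icc' hβ
    (continuous_crossEntropy_gibbs hp hpos).continuousOn
    (Set.mem_Icc.2 ⟨by rw [h1]; linarith, h⟩)
  exact ⟨θ, hθ.1, he⟩

lemma exists_gibbs_of_crossEntropy_le (hp : p ∈ stdSimplex ℝ (Fin m)) (hpos : ∀ a, 0 < p a)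
    {ε β : ℝ} (hε : 0 < ε) (h : crossEntropy p (gibbs p β) ≤ shannonEntropy p - ε) :
    ∃ θ, θ ≤ β ∧ crossEntropy p (gibbs p θ) = shannonEntropy p - ε := by
  have h1 := crossEntropy_gibbs_one hp
  have hβ : 1 ≤ β := by
    by_contra! hlt
    have : crossEntropy p (gibbs p 1) ≤ crossEntropy p (gibbs p β) :=
      crossEntropy_gibbs_antitone hp hpos hlt.le
    linarith
  obtain ⟨θ, hθ, he⟩ := intermediate_value_Icc' hβ
    (continuous_crossEntropy_gibbs hp hpos).continuousOn
    (Set.mem_Icc.2 ⟨h, by rw [h1]; linarith⟩)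
  exact ⟨θ, hθ.2, he⟩

variable {lminus lplus : Fin m → ℝ} {ε : ℝ}

/-- `l*(α)` is interchangeable with a Gibbs distribution that meets the constraint. -/
lemma exists_gibbs_lStar (hp : p ∈ stdSimplex ℝ (Fin m)) (hpos : ∀ a, 0 < p a) (hε : 0 < ε)
    (hminus : (∃ l, IsLMinus p ε l) → IsLMinus p ε lminus)
    (hplus : (∃ l, IsLPlus p ε l) → IsLPlus p ε lplus) (α : ℝ) :
    ∃ θ, shannonEntropy (lStar p ε lminus lplus α) = shannonEntropy (gibbs p θ) ∧
      crossEntropy p (lStar p ε lminus lplus α) = crossEntropy p (gibbs p θ) ∧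
      lStar p ε lminus lplus α ∈ stdSimplex ℝ (Fin m) ∧
      shannonEntropy p - ε ≤ crossEntropy p (gibbs p θ) ∧
      crossEntropy p (gibbs p θ) ≤ shannonEntropy p + ε ∧
      (1 / (1 + α) < θ → crossEntropy p (gibbs p θ) = shannonEntropy p + ε) ∧
      (θ < 1 / (1 + α) → crossEntropy p (gibbs p θ) = shannonEntropy p - ε) := by
  have heta : eta p α = crossEntropy p (gibbs p (1 / (1 + α))) := rfl
  unfold lStar
  split_ifs with h1 h2
  · obtain ⟨θ, hle, he⟩ := exists_gibbs_of_crossEntropy_le hp hpos hε (heta ▸ h1)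
    have hg := gibbs_isLPlus hp hpos he
    have hl := hplus ⟨_, hg⟩
    exact ⟨θ, hl.shannonEntropy_eq hg, (hl.crossEntropy_eq hpos).trans he.symm, hl.1.1,
      he.ge, by linarith, fun h => absurd h (not_lt.2 hle), fun _ => he⟩
  · exact ⟨1 / (1 + α), rfl, rfl, gibbs_mem hp hpos _, by linarith, by linarith,
      fun h => absurd h (lt_irrefl _), fun h => absurd h (lt_irrefl _)⟩
  · obtain ⟨θ, hle, he⟩ := exists_gibbs_of_crossEntropy_ge hp hpos hε (heta ▸ not_lt.1 h2)
    have hg := gibbs_isLMinus hp hpos he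
    have hl := hminus ⟨_, hg⟩
    exact ⟨θ, hl.shannonEntropy_eq hg, (hl.crossEntropy_eq hpos).trans he.symm, hl.1.1,
      by linarith, he.le, fun _ => he, fun h => absurd h (not_lt.2 hle)⟩

/-- `l*(α)` maximizes `α h(l) - D(l‖p)` under the cross entropy constraint. -/
lemma mul_shannonEntropy_sub_relEntropy_le (hp : p ∈ stdSimplex ℝ (Fin m))
    (hpos : ∀ a, 0 < p a) (hε : 0 < ε)
    (hminus : (∃ l, IsLMinus p ε l) → IsLMinus p ε lminus)
    (hplus : (∃ l, IsLPlus p ε l) → IsLPlus p ε lplus) {α : ℝ} (hα : -1 < α) {l : Fin m → ℝ}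
    (hl : l ∈ stdSimplex ℝ (Fin m)) (hlo : shannonEntropy p - ε ≤ crossEntropy p l)
    (hhi : crossEntropy p l ≤ shannonEntropy p + ε) :
    α * shannonEntropy l - relEntropy l p ≤
      α * shannonEntropy (lStar p ε lminus lplus α)
        - relEntropy (lStar p ε lminus lplus α) p := by
  obtain ⟨θ, h1, h2, -, -, -, h3, h4⟩ := exists_gibbs_lStar hp hpos hε hminus hplus α
  rw [relEntropy_eq hpos, relEntropy_eq hpos, h1, h2]
  have hα' : 0 < 1 + α := by linarith
  have hle := shannonEntropy_le_log_partition hp hpos θ hl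
  have heq := shannonEntropy_gibbs hp hpos θ
  have hsign : (θ - 1 / (1 + α)) * crossEntropy p l
      ≤ (θ - 1 / (1 + α)) * crossEntropy p (gibbs p θ) := by
    rcases lt_trichotomy (1 / (1 + α)) θ with h | h | h
    · rw [h3 h]; exact mul_le_mul_of_nonneg_left hhi (by linarith)
    · simp [h]
    · rw [h4 h]; exact mul_le_mul_of_nonpos_left hlo (by linarith)
  have hfin : shannonEntropy l - 1 / (1 + α) * crossEntropy p l
      ≤ shannonEntropy (gibbs p θ) - 1 / (1 + α) * crossEntropy p (gibbs p θ) := by linarith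
  have := mul_le_mul_of_nonneg_left hfin hα'.le
  rw [mul_sub, mul_sub, ← mul_assoc, ← mul_assoc, mul_one_div_cancel hα'.ne'] at this
  linarith

/-- The pieces agree at the thresholds: where `eta` meets an end of the window, `tilted` is itself a
maximizer for that end. -/
lemma continuousOn_shannonEntropy_lStar (hp : p ∈ stdSimplex ℝ (Fin m)) (hpos : ∀ a, 0 < p a)
    (hε : 0 < ε) (hminus : (∃ l, IsLMinus p ε l) → IsLMinus p ε lminus)
    (hplus : (∃ l, IsLPlus p ε l) → IsLPlus p ε lplus) :
    ContinuousOn (fun α => shannonEntropy (lStar p ε lminus lplus α)) (Set.Ioi (-1)) := by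
  rw [continuousOn_iff_continuous_domRestrict]
  have hβ : Continuous fun α : Set.Ioi (-1 : ℝ) => 1 / (1 + (α : ℝ)) :=
    continuous_const.div (by fun_prop) fun α => by have := α.2.out; linarith
  have hη : Continuous fun α : Set.Ioi (-1 : ℝ) => eta p α :=
    (continuous_crossEntropy_gibbs hp hpos).comp hβ
  have hh : Continuous fun α : Set.Ioi (-1 : ℝ) => shannonEntropy (tilted p α) :=
    (continuous_shannonEntropy_gibbs hp hpos).comp hβ
  -- The inner strict test is flipped to a non-strict one so that `Continuous.if_le` applies twice.
  have heq : (Set.Ioi (-1 : ℝ)).domRestrict (fun α => shannonEntropy (lStar p ε lminus lplus α))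
      = fun α : Set.Ioi (-1 : ℝ) => if eta p α ≤ shannonEntropy p - ε then shannonEntropy lplus
        else if shannonEntropy p + ε ≤ eta p α then shannonEntropy lminus
        else shannonEntropy (tilted p α) := by
    ext α
    simp only [Set.domRestrict_apply, lStar]
    simp only [← not_lt, ite_not]
    split_ifs <;> rfl
  rw [heq]
  refine Continuous.if_le continuous_const
    (Continuous.if_le continuous_const hh continuous_const hη fun α h => ?_) hη continuous_const
    fun α h => ?_
  · have hg : IsLMinus p ε (tilted p α) := gibbs_isLMinus hp hpos h.symm
    exact (hminus ⟨_, hg⟩).shannonEntropy_eq hg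
  · rw [if_neg (by linarith)]
    have hg : IsLPlus p ε (tilted p α) := gibbs_isLPlus hp hpos h
    exact (hplus ⟨_, hg⟩).shannonEntropy_eq hg

lemma regularSCGF_conditionedSource (hp : p ∈ stdSimplex ℝ (Fin m)) (hpos : ∀ a, 0 < p a)
    (hε : 0 < ε) (hminus : (∃ l, IsLMinus p ε l) → IsLMinus p ε lminus)
    (hplus : (∃ l, IsLPlus p ε l) → IsLPlus p ε lplus) {G : (k : ℕ) → Word m k → ℕ}
    (hG : ∀ k, IsGuesswork (conditionedSource (iidSource p) (shannonEntropy p) ε k) (G k)) :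
    RegularSCGF (conditionedSource (iidSource p) (shannonEntropy p) ε) G
      (fun α => α * shannonEntropy (lStar p ε lminus lplus α)
        - relEntropy (lStar p ε lminus lplus α) p) := by
  have key : ∀ α : ℝ, -1 < α → ∃ r,
      α * shannonEntropy (lStar p ε lminus lplus α) - relEntropy (lStar p ε lminus lplus α) p
        = (1 + α) * r ∧
      (∀ᶠ k in atTop,
        0 < ∑ w, conditionedSource (iidSource p) (shannonEntropy p) ε k w ^ (1 / (1 + α))) ∧
      Tendsto (fun k : ℕ => 1 / (k : ℝ) * Real.log
        (∑ w, conditionedSource (iidSource p) (shannonEntropy p) ε k w ^ (1 / (1 + α))))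
        atTop (𝓝 r) := by
    intro α hα
    have hα' : 0 < 1 + α := by linarith
    obtain ⟨θ, h1, h2, -, h3, h4, h5, h6⟩ := exists_gibbs_lStar hp hpos hε hminus hplus α
    have hT := tendsto_log_typicalSum hp hpos hε h3 h4 h5 h6
    refine ⟨_, ?_, tendsto_log_sum_conditionedSource_rpow hp hpos hε (by positivity) hT.1 hT.2⟩
    rw [relEntropy_eq hpos, h1, h2]
    field_simp
    ring
  refine ⟨fun α hα => ?_, fun α hα => ?_, fun α => shannonEntropy (lStar p ε lminus lplus α),
    continuousOn_shannonEntropy_lStar hp hpos hε hminus hplus, fun α hα => ?_⟩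
  · obtain ⟨r, hr, hS, hlim⟩ := key α hα
    rw [hr]
    exact hasSCGF_of_tendsto hG (fun k w => conditionedSource_nonneg hpos w) hα hS hlim
  · rcases eq_or_ne α 0 with rfl | h0
    · refine ⟨shannonEntropy p, ?_, ?_⟩
      · refine (hasSpecificEntropy_conditionedSource hp hpos hε).congr fun k => ?_
        rw [renyiEntropy, if_pos (by norm_num)]
      · have h : lStar p ε lminus lplus 0 = p := by
          have ht : tilted p 0 = p := by
            ext a
            simp [tilted, hp.2]
          have he : eta p 0 = shannonEntropy p := by rw [eta, ht]; rfl
          rw [lStar, he, ht, if_neg (by linarith), if_pos (by linarith)]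
        simp [h, relEntropy_eq hpos, crossEntropy, shannonEntropy]
    · obtain ⟨r, hr, -, hlim⟩ := key α hα
      have hα' : 0 < 1 + α := by linarith
      have hβ : 1 / (1 + α) ≠ 1 := by
        rw [Ne, div_eq_one_iff_eq hα'.ne']
        exact fun h => h0 (by linarith)
      refine ⟨1 / (1 - 1 / (1 + α)) * r, ?_, ?_⟩
      · refine (hlim.const_mul _).congr fun k => ?_
        rw [renyiEntropy, if_neg hβ, mul_left_comm]
      · have h1 : 1 - 1 / (1 + α) = α / (1 + α) := by field_simp; ring
        rw [hr, h1]
        field_simp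
  -- The maximizer at x is still admissible at y, so its affine function lies below Λ and touches it
  -- at x; the slope is its entropy.
  · refine hasDerivAt_of_subgradient (s := Set.Ioi (-1)) isOpen_Ioi
      (Λ := fun α => α * shannonEntropy (lStar p ε lminus lplus α)
        - relEntropy (lStar p ε lminus lplus α) p)
      (ψ := fun α => shannonEntropy (lStar p ε lminus lplus α)) (fun x _ y hy => ?_)
      (continuousOn_shannonEntropy_lStar hp hpos hε hminus hplus) hα
    obtain ⟨θ, -, h2, h3, h4, h5, -, -⟩ := exists_gibbs_lStar hp hpos hε hminus hplus x
    have := mul_shannonEntropy_sub_relEntropy_le hp hpos hε hminus hplus hy h3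
      (h2 ▸ h4) (h2 ▸ h5)
    linarith

end Selection

end Guesswork

/-! ### Assembly of the cases -/

theorem lemma1 (m : ℕ) (p : Fin m → ℝ) (hp : p ∈ stdSimplex ℝ (Fin m)) (hpos : ∀ a, 0 < p a)
    (ε : ℝ) (hε : 0 < ε)
    -- the specific Shannon entropy of the words of i.i.d. letters
    (H : ℝ) (hH : HasSpecificEntropy (iidSource p) H)
    -- the maximizers `l⁻` and `l⁺`, should they exist
    (lminus lplus : Fin m → ℝ)
    (hminus : (∃ l, IsLMinus p ε l) → IsLMinus p ε lminus)
    (hplus : (∃ l, IsLPlus p ε l) → IsLPlus p ε lplus)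
    -- Guesswork functions for the two sources
    (GU GW : (k : ℕ) → Word m k → ℕ)
    (hGU : ∀ k, IsGuesswork (uniformSource (iidSource p) H ε k) (GU k))
    (hGW : ∀ k, IsGuesswork (conditionedSource (iidSource p) H ε k) (GW k)) :
    -- uniform source, under `h(p) + ε ≤ log m`
    (shannonEntropy p + ε ≤ Real.log m →
      RegularSCGF (uniformSource (iidSource p) H ε) GU (fun α => α * shannonEntropy lminus)) ∧
    -- uniform source, when `log m < h(p) + ε`
    (Real.log m < shannonEntropy p + ε →
      (shannonEntropy p + ε < -(1 / (m : ℝ)) * ∑ a, Real.log (p a) →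
        RegularSCGF (uniformSource (iidSource p) H ε) GU
          (fun α => α * shannonEntropy lminus)) ∧
      (-(1 / (m : ℝ)) * ∑ a, Real.log (p a) ≤ shannonEntropy p + ε →
        RegularSCGF (uniformSource (iidSource p) H ε) GU (fun α => α * Real.log m))) ∧
    -- conditioned source
    RegularSCGF (conditionedSource (iidSource p) H ε) GW
      (fun α => α * shannonEntropy (lStar p ε lminus lplus α)
        - relEntropy (lStar p ε lminus lplus α) p) := by
  obtain rfl := hH.eq_of_iid hp hpos
  have hone := crossEntropy_gibbs_one hp
  have hU : ∀ θ : ℝ, 0 ≤ θ →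
      shannonEntropy p - ε ≤ crossEntropy p (gibbs p θ) →
      crossEntropy p (gibbs p θ) ≤ shannonEntropy p + ε →
      (0 < θ → crossEntropy p (gibbs p θ) = shannonEntropy p + ε) →
      RegularSCGF (uniformSource (iidSource p) (shannonEntropy p) ε) GU
        (fun α => α * shannonEntropy (gibbs p θ)) := by
    intro θ hθ hlo hhi h
    -- Exponent 0 counts typical words; as θ ≥ 0, the lower end of the window is never forced.
    have hT := tendsto_log_typicalSum (β := 0) hp hpos hε hlo hhi h
      (fun h' => absurd h' (not_lt.2 hθ))
    rw [zero_mul, sub_zero] at hT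
    exact regularSCGF_uniformSource hGU hT.1 hT.2
  have hUminus : shannonEntropy p + ε ≤ crossEntropy p (gibbs p 0) →
      RegularSCGF (uniformSource (iidSource p) (shannonEntropy p) ε) GU
        (fun α => α * shannonEntropy lminus) := by
    intro h
    obtain ⟨θ, hθ, he⟩ := exists_gibbs_of_crossEntropy_ge hp hpos hε h
    have hg := gibbs_isLMinus hp hpos he
    rw [(hminus ⟨_, hg⟩).shannonEntropy_eq hg]
    exact hU θ hθ (by linarith) he.le fun _ => he
  have hcross : crossEntropy p (gibbs p 0) = -(1 / (m : ℝ)) * ∑ a, Real.log (p a) := by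
    simp [crossEntropy, gibbs, ← Finset.mul_sum]
  have hent : shannonEntropy (gibbs p 0) = Real.log m := by
    simp [shannonEntropy_gibbs hp hpos]
  refine ⟨fun h => hUminus ?_, fun _ => ⟨fun h => hUminus ?_, fun h => ?_⟩,
    regularSCGF_conditionedSource hp hpos hε hminus hplus hGW⟩
  -- The uniform letter law has entropy log m, at most its cross entropy, so this case also puts it
  -- at or beyond the upper end.
  · have := shannonEntropy_le_log_partition hp hpos 1 (gibbs_mem hp hpos 0)
    simp only [Real.rpow_one, hp.2, Real.log_one, hent] at this
    linarith
  · rw [hcross]; exact h.le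
  -- Here the uniform letter law itself lies in the window, so θ = 0 is optimal.
  · rw [← hent]
    have : crossEntropy p (gibbs p 1) ≤ crossEntropy p (gibbs p 0) :=
      crossEntropy_gibbs_antitone hp hpos zero_le_one
    exact hU 0 le_rfl (by linarith) (hcross ▸ h) fun h' => absurd h' (lt_irrefl _)
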